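/- **Setting.** The target state $V\in\{0,1\}$ (absent/present) has a priori distribution $\pi$, and the received signal $Y$, with values in a $\sigma$-finite measure space $\mathbb Y$, has conditional density $p(y|v)$. Write $p(v,y)=\pi(v)p(y|v)$, $p(y)=\sum_v p(v,y)$ and $P(v|y)=p(v,y)/p(y)$. Logarithms are to base $2$. It is assumed that $p\log p$ is integrable, so that the entropy $h(Y)$ is finite; $H(V)$ and $h(V,Y)$ are then finite too. The detection information (DI) is $I(V;Y)=\mathbb E\left[\log\frac{p(Y|V)}{p(Y)}\right]$. For $m$ i.i.d. snapshots, $(V^m,Y^m)$ has density $\prod_{i=1}^m p(v_i,y_i)$. A (possibly randomized) detector is a Markov kernel which produces from $Y^m$ a decision $\hat V^m\in\{0,1\}^m$, so that $V^m\to Y^m\to\hat V^m$ is a Markov chain. The sampling a posteriori (SAP) detector draws $\hat v^m$ with probability $\prod_i P(\hat v_i|y_i)$. For $\varepsilon>0$ let $\mathbb A_\varepsilon^{(m)}$ be the set of jointly typical pairs $(v^m,y^m)$, i.e. those with $$\Big|-\tfrac1m\sum_i\log\pi(v_i)-H(V)\Big|<\varepsilon,\quad \Big|-\tfrac1m\sum_i\log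 p(y_i)-h(Y)\Big|<\varepsilon,\quad \Big|-\tfrac1m\sum_i\log p(v_i,y_i)-h(V,Y)\Big|<\varepsilon .$$ The decision is successful ($E=0$) if $(\hat V^m,Y^m)\in\mathbb A_\varepsilon^{(m)}$ and failed ($E=1$) otherwise; $P_f^{(m)}=\Pr(E=1)$. The empirical DI is $$I^{(m)}(V;\hat V|E=0)=H(V)-\tfrac1m H(V^m\,|\,Y^m,E=0),$$ where $H(V^m|Y^m,E=0)$ is the conditional entropy of $V^m$ given $Y^m$ under the law conditioned on $E=0$. **Theorem (Target Detection Theorem).** For every $\varepsilon>0$: 1. (Achievability.) For the SAP detector, $I^{(m)}(V;\hat V|E=0)>I(V;Y)-2\varepsilon$ for all sufficiently large $m$, and $P_f^{(m)}\to0$ as $m\to\infty$. Moreover, every $R<I(V;Y)$ is achievable: there is a sequence of detectors with $P_f^{(m)}\to0$ and $I^{(m)}(V;\hat V|E=0)>R$ for all large $m$. 2. (Converse.) No value above $I(V;Y)$ is achievable: for every sequence of detectors with $P_f^{(m)}\to0$ and every $R>I(V;Y)$, one has $I^{(m)}(V;\hat V|E=0)<R$ for all large $m$, i.e. $\limsup_{m}I^{(m)}(V;\hat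 V|E=0)\le I(V;Y)$. The integrability assumption holds for the radar detection channel on $\mathbb C^N$ ($N\ge1$): for noise level $N_0>0$, a continuous baseband signal $\psi$, a constant scattering modulus $\alpha$, a phase uniform on $[0,2\pi]$ and a delay uniform on $[-N/2,N/2)$, $$p(\mathbf y|v)=\frac1N\int_{-N/2}^{N/2}\frac1{2\pi}\int_0^{2\pi}\Big(\frac1{\pi N_0}\Big)^N\exp\Big(-\frac1{N_0}\sum_{n=-N/2}^{N/2-1}\big|y(n)-v\alpha e^{j\varphi}\psi(n-x)\big|^2\Big)\,d\varphi\,dx .$$ -/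

import Mathlib

open MeasureTheory ProbabilityTheory Filter Topology

noncomputable section

/-! ### Conditional entropy -/

/-- The conditional entropy `H(X | Y)`, in bits, of a random variable `X` with values in a finite
set given a random variable `Y`, under the probability measure `P`:
`E[- ∑ a, P(X = a | Y) log₂ P(X = a | Y)]`. -/
def condEntropy {Ω A B : Type*} [MeasurableSpace Ω] [Fintype A] [MeasurableSpace B]
    (X : Ω → A) (Y : Ω → B) (P : Measure Ω) : ℝ :=
  ∫ ω, ∑ a : A, -((P⟦X ⁻¹' {a} | MeasurableSpace.comap Y inferInstance⟧) ω *
    Real.logb 2 ((P⟦X ⁻¹' {a} | MeasurableSpace.comap Y inferInstance⟧) ω)) ∂P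

/-! ### Target detection systems -/

/-- A target detection system: the target state takes the values `0` (absent) and `1` (present)
with a priori probabilities `prior`, and the detection channel is given by the conditional
densities `chan v = p(· | v)` of the received signal, with respect to a reference measure (Lebesgue
measure in the radar model) on the space `𝕐` of received signals. -/
structure DetectionSystem (𝕐 : Type*) [MeasurableSpace 𝕐] where
  /-- the reference measure on the signal space -/
  ref : Measure 𝕐
  sigmaFinite_ref : SigmaFinite ref
  /-- the a priori distribution of the target state -/
  prior : Fin 2 → ℝ
  prior_nonneg : ∀ v, 0 ≤ prior v
  prior_sum : ∑ v, prior v = 1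
  /-- the channel density `p(y | v)` -/
  chan : Fin 2 → 𝕐 → ℝ
  chan_measurable : ∀ v, Measurable (chan v)
  chan_nonneg : ∀ v y, 0 ≤ chan v y
  chan_lintegral : ∀ v, ∫⁻ y, ENNReal.ofReal (chan v y) ∂ref = 1

attribute [instance] DetectionSystem.sigmaFinite_ref

namespace DetectionSystem

variable {𝕐 : Type*} [MeasurableSpace 𝕐] (S : DetectionSystem 𝕐)

/-- The joint density `p(v, y) = π(v) p(y | v)`. -/
def joint (v : Fin 2) (y : 𝕐) : ℝ := S.prior v * S.chan v y

/-- The density `p(y) = ∑ v, π(v) p(y | v)` of the received signal. -/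
def out (y : 𝕐) : ℝ := ∑ v, S.joint v y

/-- The a priori entropy `H(V)` in bits. -/
def entropyV : ℝ := -∑ v, S.prior v * Real.logb 2 (S.prior v)

/-- The differential entropy `h(Y)` in bits. -/
def entropyY : ℝ := -∫ y, S.out y * Real.logb 2 (S.out y) ∂S.ref

/-- The joint entropy `h(V, Y)` in bits. -/
def entropyVY : ℝ := -∑ v, ∫ y, S.joint v y * Real.logb 2 (S.joint v y) ∂S.ref

/-- The differential entropy of the received signal exists and is finite. Since
`p(y) H(V | Y = y)` is integrable, the same then holds for the joint entropy. -/
def HasFiniteEntropy : Prop :=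
  Integrable (fun y => S.out y * Real.logb 2 (S.out y)) S.ref

/-- The detection information `I(Y; V) = E[log₂ (p(y | v) / p(y))]`. -/
def detectionInformation : ℝ :=
  ∑ v, ∫ y, S.joint v y * Real.logb 2 (S.chan v y / S.out y) ∂S.ref

/-- The a posteriori probability `P(v | y) = π(v) p(y | v) / p(y)`. (On the null event `p(y) = 0`
it is set to `π(v)`.) -/
def posterior (v : Fin 2) (y : 𝕐) : ℝ :=
  if S.out y = 0 then S.prior v else S.joint v y / S.out y

/-! ### The `m`-fold extension -/

/-- The joint law of the states `V^m` and the signals `Y^m` in `m` snapshots, with density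
`π(v^m) p(y^m | v^m) = ∏ i, π(v_i) * ∏ i, p(y_i | v_i)`. -/
def jointLaw (m : ℕ) : Measure ((Fin m → Fin 2) × (Fin m → 𝕐)) :=
  (Measure.count.prod (Measure.pi fun _ => S.ref)).withDensity fun x =>
    ENNReal.ofReal ((∏ i, S.prior (x.1 i)) * ∏ i, S.chan (x.1 i) (x.2 i))

/-- The set of jointly typical pairs `(v^m, y^m)`. The condition `0 < p(v_i, y_i)` only excludes
the pairs for which one of the three sample means below would be `+∞`. -/
def jointlyTypical (ε : ℝ) (m : ℕ) : Set ((Fin m → Fin 2) × (Fin m → 𝕐)) :=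
  {x | (∀ i, 0 < S.joint (x.1 i) (x.2 i)) ∧
    |-(1 / (m : ℝ)) * ∑ i, Real.logb 2 (S.prior (x.1 i)) - S.entropyV| < ε ∧
    |-(1 / (m : ℝ)) * ∑ i, Real.logb 2 (S.out (x.2 i)) - S.entropyY| < ε ∧
    |-(1 / (m : ℝ)) * ∑ i, Real.logb 2 (S.joint (x.1 i) (x.2 i)) - S.entropyVY| < ε}

/-- The conditional typical set of a sequence `y^m`. -/
def condTypical (ε : ℝ) (m : ℕ) (y : Fin m → 𝕐) : Set (Fin m → Fin 2) :=
  {v | (v, y) ∈ S.jointlyTypical ε m}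

/-! ### Detectors

A detector for `m` snapshots is a Markov kernel from `𝕐^m` to `{0,1}^m`: it turns the received
sequence, possibly using its own randomness, into a decision sequence. -/

/-- The joint law of `((V^m, Y^m), V̂^m)` when the detector `D` is used. In particular
`V^m`, `Y^m`, `V̂^m` form a Markov chain. -/
def law {m : ℕ} (D : Kernel (Fin m → 𝕐) (Fin m → Fin 2)) :
    Measure (((Fin m → Fin 2) × (Fin m → 𝕐)) × (Fin m → Fin 2)) :=
  S.jointLaw m ⊗ₘ D.prodMkLeft (Fin m → Fin 2)

/-- The event `E = 0` of a successful decision. -/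
def successful (ε : ℝ) (m : ℕ) : Set (((Fin m → Fin 2) × (Fin m → 𝕐)) × (Fin m → Fin 2)) :=
  {ω | ω.2 ∈ S.condTypical ε m ω.1.2}

/-- The probability of failed decisions. -/
def failProb (ε : ℝ) {m : ℕ} (D : Kernel (Fin m → 𝕐) (Fin m → Fin 2)) : ℝ :=
  (S.law D).real (S.successful ε m)ᶜ

/-- The empirical entropy `(1/m) H(V^m | Y^m, E = 0)`. -/
def empiricalEntropy (ε : ℝ) {m : ℕ} (D : Kernel (Fin m → 𝕐) (Fin m → Fin 2)) : ℝ :=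
  1 / (m : ℝ) * condEntropy (fun ω => ω.1.1) (fun ω => ω.1.2) (cond (S.law D) (S.successful ε m))

/-- The empirical detection information. -/
def empiricalDI (ε : ℝ) {m : ℕ} (D : Kernel (Fin m → 𝕐) (Fin m → Fin 2)) : ℝ :=
  S.entropyV - S.empiricalEntropy ε D

/-! ### The sampling a posteriori detector -/

lemma joint_measurable (v : Fin 2) : Measurable (S.joint v) :=
  (S.chan_measurable v).const_mul _

lemma out_measurable : Measurable S.out :=
  Finset.measurable_sum _ fun v _ => S.joint_measurable v

lemma posterior_measurable (v : Fin 2) : Measurable (S.posterior v) :=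
  Measurable.ite (measurableSet_eq_fun S.out_measurable measurable_const) measurable_const
    ((S.joint_measurable v).div S.out_measurable)

lemma joint_nonneg (v : Fin 2) (y : 𝕐) : 0 ≤ S.joint v y :=
  mul_nonneg (S.prior_nonneg v) (S.chan_nonneg v y)

lemma posterior_nonneg (v : Fin 2) (y : 𝕐) : 0 ≤ S.posterior v y := by
  unfold posterior
  split_ifs
  · exact S.prior_nonneg v
  · exact div_nonneg (S.joint_nonneg v y) (Finset.sum_nonneg fun v _ => S.joint_nonneg v y)

lemma posterior_sum (y : 𝕐) : ∑ v, S.posterior v y = 1 := by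
  unfold posterior
  split_ifs with h
  · exact S.prior_sum
  · rw [← Finset.sum_div]
    exact div_self h

/-- The sampling a posteriori detector: given `y^m`, it draws `v̂^m` with the a posteriori
probability `P(v̂^m | y^m) = ∏ i, P(v̂_i | y_i)`. -/
def sapDetector (m : ℕ) : Kernel (Fin m → 𝕐) (Fin m → Fin 2) where
  toFun y := ∑ v : Fin m → Fin 2,
    ENNReal.ofReal (∏ i, S.posterior (v i) (y i)) • Measure.dirac v
  measurable' := by
    refine Measure.measurable_of_measurable_coe _ fun s _ => ?_
    simp only [Measure.coe_finsetSum, Finset.sum_apply, Measure.smul_apply, smul_eq_mul]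
    refine Finset.measurable_sum _ fun v _ => Measurable.mul_const ?_ _
    exact (Finset.measurable_prod _ fun i _ =>
      (S.posterior_measurable (v i)).comp (measurable_pi_apply i)).ennreal_ofReal

instance (m : ℕ) : IsMarkovKernel (S.sapDetector m) where
  isProbabilityMeasure y := ⟨by
    change (∑ v : Fin m → Fin 2,
      ENNReal.ofReal (∏ i, S.posterior (v i) (y i)) • Measure.dirac v) Set.univ = 1
    simp only [Measure.coe_finsetSum, Finset.sum_apply, Measure.smul_apply, smul_eq_mul,
      measure_univ, mul_one]
    rw [← ENNReal.ofReal_sum_of_nonneg fun v _ =>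
      Finset.prod_nonneg fun i _ => S.posterior_nonneg _ _]
    have h := Finset.prod_univ_sum (fun _ : Fin m => (Finset.univ : Finset (Fin 2)))
      (fun i v => S.posterior v (y i))
    simp only [S.posterior_sum, Finset.prod_const_one, Fintype.piFinset_univ] at h
    rw [← h, ENNReal.ofReal_one]⟩

end DetectionSystem

/-! ### The radar detection channel -/

/-- The noise-free received samples for the target state `v`, delay `x` and phase `φ`, at the
sampling times `-N/2, …, N/2 - 1`, for the baseband signal `ψ` and the constant modulus `α` of
the scattering coefficient. -/
def radarEcho (N : ℕ) (ψ : ℝ → ℂ) (α : ℝ) (v : Fin 2) (x φ : ℝ) : Fin N → ℂ := fun n =>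
  ((v : ℕ) : ℂ) * (α * Complex.exp (Complex.I * φ)) * ψ (-(N : ℝ) / 2 + (n : ℕ) - x)

/-- The density of a vector of `N` independent circular complex Gaussian variables of
variance `N₀`, centred at `c`. -/
def complexGaussianDensity (N : ℕ) (N₀ : ℝ) (c y : Fin N → ℂ) : ℝ :=
  (1 / (Real.pi * N₀)) ^ N * Real.exp (-(1 / N₀) * ∑ n, ‖y n - c n‖ ^ 2)

/-- The equivalent detection channel `p(y | v)` for one target, with the phase uniform on
`[0, 2π]` and the delay uniform on `[-N/2, N/2)`. -/
def radarChannel (N : ℕ) (N₀ : ℝ) (ψ : ℝ → ℂ) (α : ℝ) (v : Fin 2) (y : Fin N → ℂ) : ℝ :=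
  1 / (N : ℝ) * ∫ x in (-(N : ℝ) / 2)..((N : ℝ) / 2), 1 / (2 * Real.pi) *
    ∫ φ in (0 : ℝ)..(2 * Real.pi), complexGaussianDensity N N₀ (radarEcho N ψ α v x φ) y

lemma complexGaussianDensity_nonneg (N : ℕ) {N₀ : ℝ} (h : 0 < N₀) (c y : Fin N → ℂ) :
    0 ≤ complexGaussianDensity N N₀ c y := by
  unfold complexGaussianDensity
  positivity

lemma complexGaussianDensity_lintegral (N : ℕ) {N₀ : ℝ} (h : 0 < N₀) (c : Fin N → ℂ) :
    ∫⁻ y, ENNReal.ofReal (complexGaussianDensity N N₀ c y) = 1 := by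
  have key : ∫ z : ℂ, 1 / (Real.pi * N₀) * Real.exp (-(1 / N₀) * ‖z‖ ^ 2) = 1 := by
    rw [integral_const_mul, GaussianFourier.integral_rexp_neg_mul_sq_norm (by positivity)]
    have hpi := Real.pi_ne_zero
    simp [Complex.finrank_real_complex]
    field_simp
  have hprod : ∀ y : Fin N → ℂ, complexGaussianDensity N N₀ 0 y =
      ∏ n, (1 / (Real.pi * N₀) * Real.exp (-(1 / N₀) * ‖y n‖ ^ 2)) := by
    intro y
    simp [complexGaussianDensity, Finset.prod_mul_distrib, ← Real.exp_sum, Finset.mul_sum]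
  have hone : ∫ y, complexGaussianDensity N N₀ 0 y = 1 := by
    simp_rw [hprod]
    rw [integral_fintype_prod_volume_eq_pow
      (fun z : ℂ => 1 / (Real.pi * N₀) * Real.exp (-(1 / N₀) * ‖z‖ ^ 2)), key, one_pow]
  have hint : Integrable (complexGaussianDensity N N₀ 0) := by
    by_contra hn
    rw [integral_undef hn] at hone
    exact zero_ne_one hone
  have hshift : ∀ y, complexGaussianDensity N N₀ c y = complexGaussianDensity N N₀ 0 (y - c) := by
    intro y
    simp [complexGaussianDensity]
  simp_rw [hshift]
  rw [lintegral_sub_right_eq_self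
      (fun y => ENNReal.ofReal (complexGaussianDensity N N₀ 0 y)) c,
    ← ofReal_integral_eq_lintegral_ofReal hint
      (ae_of_all _ fun y => complexGaussianDensity_nonneg N h 0 y), hone, ENNReal.ofReal_one]

lemma radar_continuous (N : ℕ) (N₀ : ℝ) {ψ : ℝ → ℂ} (hψ : Continuous ψ) (α : ℝ) (v : Fin 2) :
    Continuous fun q : ((Fin N → ℂ) × ℝ) × ℝ =>
      complexGaussianDensity N N₀ (radarEcho N ψ α v q.1.2 q.2) q.1.1 := by
  unfold complexGaussianDensity radarEcho
  fun_prop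

lemma radar_inner_continuous (N : ℕ) (N₀ : ℝ) {ψ : ℝ → ℂ} (hψ : Continuous ψ) (α : ℝ)
    (v : Fin 2) : Continuous fun q : (Fin N → ℂ) × ℝ => 1 / (2 * Real.pi) *
      ∫ φ in (0 : ℝ)..(2 * Real.pi),
        complexGaussianDensity N N₀ (radarEcho N ψ α v q.2 φ) q.1 :=
  continuous_const.mul <| intervalIntegral.continuous_parametric_intervalIntegral_of_continuous'
    (f := fun (q : (Fin N → ℂ) × ℝ) φ =>
      complexGaussianDensity N N₀ (radarEcho N ψ α v q.2 φ) q.1)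
    (radar_continuous N N₀ hψ α v) _ _

lemma radarChannel_continuous (N : ℕ) (N₀ : ℝ) {ψ : ℝ → ℂ} (hψ : Continuous ψ) (α : ℝ)
    (v : Fin 2) : Continuous (radarChannel N N₀ ψ α v) :=
  continuous_const.mul <| intervalIntegral.continuous_parametric_intervalIntegral_of_continuous'
    (radar_inner_continuous N N₀ hψ α v) _ _

lemma radarChannel_nonneg (N : ℕ) {N₀ : ℝ} (h : 0 < N₀) (ψ : ℝ → ℂ) (α : ℝ) (v : Fin 2)
    (y : Fin N → ℂ) : 0 ≤ radarChannel N N₀ ψ α v y := by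
  refine mul_nonneg (by positivity) (intervalIntegral.integral_nonneg ?_ fun x _ =>
    mul_nonneg (by positivity) (intervalIntegral.integral_nonneg (by positivity) fun φ _ =>
      complexGaussianDensity_nonneg N h _ _))
  have : (0 : ℝ) ≤ N := Nat.cast_nonneg N
  linarith

lemma ofReal_mean {a b : ℝ} (hab : a < b) {f : ℝ → ℝ} (hf : Continuous f) (h0 : ∀ x, 0 ≤ f x) :
    ENNReal.ofReal (1 / (b - a) * ∫ x in a..b, f x) =
      ENNReal.ofReal (1 / (b - a)) * ∫⁻ x in Set.Ioc a b, ENNReal.ofReal (f x) := by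
  rw [ENNReal.ofReal_mul (by have := sub_pos.2 hab; positivity),
    intervalIntegral.integral_of_le hab.le,
    ofReal_integral_eq_lintegral_ofReal (hf.integrableOn_Ioc) (ae_of_all _ h0)]

lemma mean_one {a b : ℝ} (hab : a < b) :
    ENNReal.ofReal (1 / (b - a)) * ∫⁻ _ in Set.Ioc a b, 1 = 1 := by
  have h := sub_pos.2 hab
  rw [setLIntegral_one, Real.volume_Ioc, ← ENNReal.ofReal_mul (by positivity),
    one_div_mul_cancel h.ne', ENNReal.ofReal_one]

lemma lintegral_mean_eq_one {Y : Type*} [TopologicalSpace Y] [MeasurableSpace Y]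
    [OpensMeasurableSpace (Y × ℝ)] {μ : Measure Y} [SFinite μ] {a b : ℝ} (hab : a < b)
    {f : Y × ℝ → ℝ} (hf : Continuous f) (h0 : ∀ q, 0 ≤ f q)
    (h1 : ∀ x, ∫⁻ y, ENNReal.ofReal (f (y, x)) ∂μ = 1) :
    ∫⁻ y, ENNReal.ofReal (1 / (b - a) * ∫ x in a..b, f (y, x)) ∂μ = 1 := by
  have m : Measurable fun q => ENNReal.ofReal (f q) := hf.measurable.ennreal_ofReal
  have e : ∀ y, ENNReal.ofReal (1 / (b - a) * ∫ x in a..b, f (y, x)) =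
      ENNReal.ofReal (1 / (b - a)) * ∫⁻ x in Set.Ioc a b, ENNReal.ofReal (f (y, x)) := fun y =>
    ofReal_mean hab (hf.comp (Continuous.prodMk_right y)) fun x => h0 (y, x)
  simp_rw [e]
  rw [lintegral_const_mul _ m.lintegral_prod_right', lintegral_lintegral_swap m.aemeasurable]
  simp_rw [h1]
  exact mean_one hab

lemma radar_inner_lintegral (N : ℕ) {N₀ : ℝ} (h : 0 < N₀) {ψ : ℝ → ℂ}
    (hψ : Continuous ψ) (α : ℝ) (v : Fin 2) (x : ℝ) :
    ∫⁻ y, ENNReal.ofReal (1 / (2 * Real.pi) * ∫ φ in (0 : ℝ)..(2 * Real.pi),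
      complexGaussianDensity N N₀ (radarEcho N ψ α v x φ) y) = 1 := by
  have hc : Continuous fun q : (Fin N → ℂ) × ℝ =>
      complexGaussianDensity N N₀ (radarEcho N ψ α v x q.2) q.1 := by
    unfold complexGaussianDensity radarEcho
    fun_prop
  have key := lintegral_mean_eq_one (μ := (volume : Measure (Fin N → ℂ))) Real.two_pi_pos hc
    (fun q => complexGaussianDensity_nonneg N h _ _)
    (fun φ => complexGaussianDensity_lintegral N h (radarEcho N ψ α v x φ))
  simpa only [sub_zero] using key

lemma radarChannel_lintegral {N : ℕ} (hN : 0 < N) {N₀ : ℝ} (h : 0 < N₀) {ψ : ℝ → ℂ}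
    (hψ : Continuous ψ) (α : ℝ) (v : Fin 2) :
    ∫⁻ y, ENNReal.ofReal (radarChannel N N₀ ψ α v y) = 1 := by
  have hN' : (0 : ℝ) < N := Nat.cast_pos.2 hN
  have h1 : -(N : ℝ) / 2 < (N : ℝ) / 2 := by linarith
  have e1 : (N : ℝ) / 2 - -(N : ℝ) / 2 = N := by ring
  have key := lintegral_mean_eq_one (μ := (volume : Measure (Fin N → ℂ))) h1
    (radar_inner_continuous N N₀ hψ α v)
    (fun q => mul_nonneg (by positivity)
      (intervalIntegral.integral_nonneg Real.two_pi_pos.le fun φ _ =>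
        complexGaussianDensity_nonneg N h _ _))
    (radar_inner_lintegral N h hψ α v)
  rw [e1] at key
  exact key

/-- The detection system of the radar model with `N` complex samples per snapshot. -/
def radarSystem (N : ℕ) (hN : 0 < N) (N₀ : ℝ) (hN₀ : 0 < N₀) (ψ : ℝ → ℂ) (hψ : Continuous ψ)
    (α : ℝ) (prior : Fin 2 → ℝ) (hprior : ∀ v, 0 ≤ prior v) (hsum : ∑ v, prior v = 1) :
    DetectionSystem (Fin N → ℂ) where
  ref := volume
  sigmaFinite_ref := inferInstance
  prior := prior
  prior_nonneg := hprior
  prior_sum := hsum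
  chan := radarChannel N N₀ ψ α
  chan_measurable v := (radarChannel_continuous N N₀ hψ α v).measurable
  chan_nonneg v y := radarChannel_nonneg N hN₀ ψ α v y
  chan_lintegral v := radarChannel_lintegral hN hN₀ hψ α v

end

/-!
Everything rests on one observation. Since `V^m → Y^m → V̂^m` is a Markov chain and the success
event depends on `(V̂^m, Y^m)` only, conditioning on success does not alter the a posteriori law
of `V^m`: given `Y^m` and `E = 0` it is still `∏ i, P(v_i | y_i)` (`condProb_successLaw`). Hence
`(1/m) H(V^m | Y^m, E = 0)` is the mean, given `E = 0`, of the sample average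
`(1/m) ∑ i, H(V | Y = Y_i)` (`empiricalEntropy_eq`), whatever the detector is.

By the law of large numbers in `L¹` this average tends to `H(V | Y)` in mean, and conditioning on an
event of probability tending to one does not affect the limit
(`enorm_empiricalEntropy_sub_le`). So for every sequence of detectors whose failure probability
tends to zero, the empirical detection information converges to `H(V) - H(V | Y) = I(V; Y)`
(`tendsto_empiricalDI`). This gives the converse, and reduces achievability to the failure
probability of the sampling a posteriori detector. For that detector `(V̂^m, Y^m)` has the same law
as `(V^m, Y^m)`, so failure is the event that independent snapshots are not jointly typical, whose
probability tends to zero by the weak law (`tendsto_jointLaw_compl_jointlyTypical`).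

In the radar model the echoes are uniformly bounded, so the signal density is dominated by a centred
Gaussian density (`exists_radarChannel_le`), and `|p log p| ≤ const * (√p + p²)` is integrable.
-/

noncomputable section

/-! ### The weak law of large numbers on finite powers -/

/-- The weak law of large numbers in `L¹`, stated on the finite powers of a probability space:
it is transported from the strong law in `L¹` on the infinite power. -/
lemma tendsto_lintegral_sampleMean_sub {Z : Type*} [MeasurableSpace Z] (μ : Measure Z)
    [IsProbabilityMeasure μ] {f : Z → ℝ} (hf : Measurable f) (hi : Integrable f μ) :
    Tendsto (fun m : ℕ => ∫⁻ z : Fin m → Z,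
      ‖1 / (m : ℝ) * ∑ i, f (z i) - ∫ x, f x ∂μ‖ₑ ∂Measure.pi fun _ => μ) atTop (𝓝 0) := by
  let P : Measure (ℕ → Z) := Measure.infinitePi fun _ => μ
  let X : ℕ → (ℕ → Z) → ℝ := fun i ω => f (ω i)
  have hmp : ∀ i, MeasurePreserving (fun ω : ℕ → Z => ω i) P μ := fun i =>
    measurePreserving_eval_infinitePi (fun _ : ℕ => μ) i
  have hXi : ∀ i, Measurable (X i) := fun i => hf.comp (measurable_pi_apply i)
  have hident : ∀ i, IdentDistrib (X i) (X 0) P P := fun i => by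
    refine ⟨(hXi i).aemeasurable, (hXi 0).aemeasurable, ?_⟩
    have h : ∀ j, P.map (X j) = μ.map f := fun j => by
      rw [← (hmp j).map_eq, Measure.map_map hf (measurable_pi_apply j)]
      rfl
    rw [h i, h 0]
  have hindep : iIndepFun X P := iIndepFun_infinitePi (X := fun _ => f) fun _ => hf
  have hint0 : ∫ ω, X 0 ω ∂P = ∫ x, f x ∂μ := by
    rw [← (hmp 0).map_eq, integral_map (measurable_pi_apply 0).aemeasurable
      hf.aestronglyMeasurable]
  have hL := strong_law_Lp (μ := P) le_rfl ENNReal.one_ne_top X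
    (memLp_one_iff_integrable.2 ((hmp 0).integrable_comp_of_integrable hi))
    (fun i j hij => hindep.indepFun hij) hident
  refine hL.congr fun m => ?_
  have hmap : P.map (fun ω (i : Fin m) => ω i) = Measure.pi fun _ => μ := by
    rw [← Measure.infinitePi_eq_pi]
    exact Measure.map_infinitePi_infinitePi_of_inj (P := fun _ : ℕ => μ) Fin.val_injective
  rw [← hmap, lintegral_map (by fun_prop) (by fun_prop), eLpNorm_one_eq_lintegral_enorm, hint0]
  refine lintegral_congr fun ω => ?_
  rw [one_div, smul_eq_mul, Finset.sum_range]

/-- Convergence in probability of the sample means. -/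
lemma tendsto_measure_sampleMean_ge {Z : Type*} [MeasurableSpace Z] (μ : Measure Z)
    [IsProbabilityMeasure μ] {f : Z → ℝ} (hf : Measurable f) (hi : Integrable f μ)
    {ε : ℝ} (hε : 0 < ε) :
    Tendsto (fun m : ℕ => (Measure.pi fun _ : Fin m => μ)
      {z | ε ≤ |1 / (m : ℝ) * ∑ i, f (z i) - ∫ x, f x ∂μ|}) atTop (𝓝 0) := by
  have h0 : ENNReal.ofReal ε ≠ 0 := by simpa using hε
  have hL := ENNReal.Tendsto.div_const (tendsto_lintegral_sampleMean_sub μ hf hi)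
    (b := ENNReal.ofReal ε) (Or.inr h0)
  rw [ENNReal.zero_div] at hL
  refine tendsto_of_tendsto_of_tendsto_of_le_of_le tendsto_const_nhds hL (fun _ => zero_le)
    fun m => ?_
  have hm : Measurable fun z : Fin m → Z =>
      ‖1 / (m : ℝ) * ∑ i, f (z i) - ∫ x, f x ∂μ‖ₑ := by fun_prop
  refine (measure_mono ?_).trans
    (meas_ge_le_lintegral_div hm.aemeasurable h0 ENNReal.ofReal_ne_top)
  intro z hz
  rw [Set.mem_ofPred_eq, ← ofReal_norm]
  exact ENNReal.ofReal_le_ofReal hz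

/-! ### Powers of a probability density -/

/-- The power of a measure with density `f` has the product density. -/
lemma pi_withDensity_ofReal {ι Z : Type*} [Fintype ι] [MeasurableSpace Z] (ν : Measure Z)
    [SigmaFinite ν] {f : Z → ℝ} (hi : Integrable f ν) (h0 : ∀ z, 0 ≤ f z) :
    (Measure.pi fun _ : ι => ν.withDensity fun z => ENNReal.ofReal (f z)) =
      (Measure.pi fun _ : ι => ν).withDensity fun z => ENNReal.ofReal (∏ i, f (z i)) := by
  have := isFiniteMeasure_withDensity_ofReal hi.2
  refine Measure.pi_eq fun s hs => ?_
  have hind : ∀ i, Integrable ((s i).indicator f) ν := fun i => hi.indicator (hs i)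
  have hprod : ∀ z : ι → Z, (Set.univ.pi s).indicator
      (fun z => ENNReal.ofReal (∏ i, f (z i))) z =
        ENNReal.ofReal (∏ i, (s i).indicator f (z i)) := by
    intro z
    by_cases hz : z ∈ Set.univ.pi s
    · rw [Set.indicator_of_mem hz]
      congr 1
      exact Finset.prod_congr rfl fun i _ => (Set.indicator_of_mem (hz i trivial) _).symm
    · rw [Set.indicator_of_notMem hz]
      obtain ⟨i, hi⟩ : ∃ i, z i ∉ s i := by simpa [Set.mem_pi] using hz
      rw [Finset.prod_eq_zero (Finset.mem_univ i) (Set.indicator_of_notMem hi _),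
        ENNReal.ofReal_zero]
  have hnn : ∀ i z, 0 ≤ (s i).indicator f z := fun i z => Set.indicator_nonneg (fun z _ => h0 z) z
  rw [withDensity_apply _ (MeasurableSet.univ_pi hs),
    ← lintegral_indicator (MeasurableSet.univ_pi hs), lintegral_congr hprod,
    ← ofReal_integral_eq_lintegral_ofReal (Integrable.fintype_prod hind)
      (ae_of_all _ fun z => Finset.prod_nonneg fun i _ => hnn i _),
    integral_fintype_prod_eq_prod,
    ENNReal.ofReal_prod_of_nonneg fun i _ => integral_nonneg (hnn i)]
  refine Finset.prod_congr rfl fun i _ => ?_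
  rw [withDensity_apply _ (hs i), ← lintegral_indicator (hs i),
    ofReal_integral_eq_lintegral_ofReal (hind i) (ae_of_all _ (hnn i))]
  refine lintegral_congr fun z => ?_
  by_cases hz : z ∈ s i <;> simp [hz]

namespace DetectionSystem

variable {𝕐 : Type*} [MeasurableSpace 𝕐] (S : DetectionSystem 𝕐)

/-! ### The law of one snapshot -/

/-- The law of `(V, Y)` for a single snapshot, with density `p(v, y)`. -/
def snapshotLaw : Measure (Fin 2 × 𝕐) :=
  (Measure.count.prod S.ref).withDensity fun x => ENNReal.ofReal (S.joint x.1 x.2)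

lemma measurable_joint_uncurry : Measurable fun x : Fin 2 × 𝕐 => S.joint x.1 x.2 :=
  measurable_from_prod_countable_right fun v => S.joint_measurable v

lemma out_nonneg (y : 𝕐) : 0 ≤ S.out y :=
  Finset.sum_nonneg fun v _ => S.joint_nonneg v y

lemma lintegral_joint (v : Fin 2) :
    ∫⁻ y, ENNReal.ofReal (S.joint v y) ∂S.ref = ENNReal.ofReal (S.prior v) := by
  simp only [joint, ENNReal.ofReal_mul (S.prior_nonneg v)]
  rw [lintegral_const_mul _ (S.chan_measurable v).ennreal_ofReal, S.chan_lintegral, mul_one]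

lemma integrable_joint (v : Fin 2) : Integrable (S.joint v) S.ref := by
  refine (lintegral_ofReal_ne_top_iff_integrable (S.joint_measurable v).aestronglyMeasurable
    (ae_of_all _ (S.joint_nonneg v))).1 ?_
  rw [lintegral_joint]
  exact ENNReal.ofReal_ne_top

lemma integral_joint (v : Fin 2) : ∫ y, S.joint v y ∂S.ref = S.prior v := by
  rw [integral_eq_lintegral_of_nonneg_ae (ae_of_all _ (S.joint_nonneg v))
    (S.joint_measurable v).aestronglyMeasurable, lintegral_joint,
    ENNReal.toReal_ofReal (S.prior_nonneg v)]

lemma integrable_out : Integrable S.out S.ref :=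
  integrable_finsetSum _ fun v _ => S.integrable_joint v

/-- Over the counting measure on a finite set, integration is summation. -/
lemma lintegral_count_prod {A B : Type*} [Fintype A] [MeasurableSpace A]
    [MeasurableSingletonClass A] [MeasurableSpace B] (ν : Measure B) [SFinite ν]
    {F : A × B → ENNReal} (hF : Measurable F) :
    ∫⁻ x, F x ∂Measure.count.prod ν = ∑ a, ∫⁻ b, F (a, b) ∂ν := by
  rw [lintegral_prod _ hF.aemeasurable, lintegral_count, tsum_fintype]

lemma lintegral_snapshotLaw {F : Fin 2 × 𝕐 → ENNReal} (hF : Measurable F) :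
    ∫⁻ x, F x ∂S.snapshotLaw = ∑ v, ∫⁻ y, ENNReal.ofReal (S.joint v y) * F (v, y) ∂S.ref := by
  have hm := S.measurable_joint_uncurry.ennreal_ofReal
  rw [snapshotLaw, lintegral_withDensity_eq_lintegral_mul _ hm hF]
  exact lintegral_count_prod S.ref (hm.mul hF)

instance : IsProbabilityMeasure S.snapshotLaw := ⟨by
  rw [← lintegral_one, S.lintegral_snapshotLaw measurable_const]
  simp only [mul_one, lintegral_joint]
  rw [← ENNReal.ofReal_sum_of_nonneg fun v _ => S.prior_nonneg v, S.prior_sum,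
    ENNReal.ofReal_one]⟩

lemma snapshotLaw_eq_sum : S.snapshotLaw =
    ∑ v, (S.ref.withDensity fun y => ENNReal.ofReal (S.joint v y)).map (Prod.mk v) := by
  refine Measure.ext_of_lintegral _ fun F hF => ?_
  rw [S.lintegral_snapshotLaw hF, lintegral_finsetSum_measure]
  refine Finset.sum_congr rfl fun v _ => ?_
  rw [lintegral_map hF measurable_prodMk_left,
    lintegral_withDensity_eq_lintegral_mul _ (S.joint_measurable v).ennreal_ofReal
      (g := fun y => F (v, y)) (hF.comp measurable_prodMk_left)]
  rfl

lemma integrable_snapshotLaw {f : Fin 2 × 𝕐 → ℝ} (hf : Measurable f)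
    (h : ∀ v, Integrable (fun y => S.joint v y * f (v, y)) S.ref) :
    Integrable f S.snapshotLaw := by
  rw [snapshotLaw_eq_sum, integrable_finsetSum_measure]
  intro v _
  rw [integrable_map_measure hf.aestronglyMeasurable measurable_prodMk_left.aemeasurable,
    integrable_withDensity_iff_integrable_smul' (S.joint_measurable v).ennreal_ofReal
      (ae_of_all _ fun _ => ENNReal.ofReal_lt_top)]
  simpa only [ENNReal.toReal_ofReal (S.joint_nonneg v _), smul_eq_mul, Function.comp_def] using h v

lemma integral_snapshotLaw {f : Fin 2 × 𝕐 → ℝ} (hf : Measurable f)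
    (h : ∀ v, Integrable (fun y => S.joint v y * f (v, y)) S.ref) :
    ∫ x, f x ∂S.snapshotLaw = ∑ v, ∫ y, S.joint v y * f (v, y) ∂S.ref := by
  have hi := S.integrable_snapshotLaw hf h
  rw [snapshotLaw_eq_sum, integrable_finsetSum_measure] at hi
  rw [snapshotLaw_eq_sum, integral_finsetSum_measure hi]
  refine Finset.sum_congr rfl fun v _ => ?_
  rw [integral_map measurable_prodMk_left.aemeasurable hf.aestronglyMeasurable,
    integral_withDensity_eq_integral_toReal_smul (S.joint_measurable v).ennreal_ofReal
      (ae_of_all _ fun _ => ENNReal.ofReal_lt_top)]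
  simp only [ENNReal.toReal_ofReal (S.joint_nonneg v _), smul_eq_mul]

/-! ### The law of `m` snapshots -/

/-- The density of `(V^m, Y^m)`. -/
def jointM {m : ℕ} (v : Fin m → Fin 2) (y : Fin m → 𝕐) : ℝ := ∏ i, S.joint (v i) (y i)

/-- The density of `Y^m`. -/
def outM {m : ℕ} (y : Fin m → 𝕐) : ℝ := ∏ i, S.out (y i)

/-- The a posteriori probability of `v^m` given `y^m`. -/
def posteriorM {m : ℕ} (v : Fin m → Fin 2) (y : Fin m → 𝕐) : ℝ := ∏ i, S.posterior (v i) (y i)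

lemma jointM_nonneg {m : ℕ} (v : Fin m → Fin 2) (y : Fin m → 𝕐) : 0 ≤ S.jointM v y :=
  Finset.prod_nonneg fun _ _ => S.joint_nonneg _ _

lemma posteriorM_nonneg {m : ℕ} (v : Fin m → Fin 2) (y : Fin m → 𝕐) : 0 ≤ S.posteriorM v y :=
  Finset.prod_nonneg fun _ _ => S.posterior_nonneg _ _

lemma posterior_le_one (v : Fin 2) (y : 𝕐) : S.posterior v y ≤ 1 := by
  rw [← S.posterior_sum y]
  exact Finset.single_le_sum (fun v _ => S.posterior_nonneg v y) (Finset.mem_univ v)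

lemma posteriorM_le_one {m : ℕ} (v : Fin m → Fin 2) (y : Fin m → 𝕐) : S.posteriorM v y ≤ 1 :=
  Finset.prod_le_one (fun _ _ => S.posterior_nonneg _ _) fun _ _ => S.posterior_le_one _ _

lemma measurable_jointM {m : ℕ} (v : Fin m → Fin 2) :
    Measurable fun y : Fin m → 𝕐 => S.jointM v y :=
  Finset.measurable_prod _ fun i _ => (S.joint_measurable (v i)).comp (measurable_pi_apply i)

lemma measurable_posteriorM {m : ℕ} (v : Fin m → Fin 2) :
    Measurable fun y : Fin m → 𝕐 => S.posteriorM v y :=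
  Finset.measurable_prod _ fun i _ => (S.posterior_measurable (v i)).comp (measurable_pi_apply i)

/-- Bayes' rule; where `p(y) = 0` both sides vanish. -/
lemma posterior_mul_out (v : Fin 2) (y : 𝕐) : S.posterior v y * S.out y = S.joint v y := by
  unfold posterior
  split_ifs with h
  · rw [h, mul_zero]
    exact ((Finset.sum_eq_zero_iff_of_nonneg fun v _ => S.joint_nonneg v y).1 h v
      (Finset.mem_univ v)).symm
  · exact div_mul_cancel₀ _ h

lemma posteriorM_mul_outM {m : ℕ} (v : Fin m → Fin 2) (y : Fin m → 𝕐) :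
    S.posteriorM v y * S.outM y = S.jointM v y := by
  simp only [posteriorM, outM, jointM, ← Finset.prod_mul_distrib, posterior_mul_out]

lemma outM_nonneg {m : ℕ} (y : Fin m → 𝕐) : 0 ≤ S.outM y :=
  Finset.prod_nonneg fun _ _ => S.out_nonneg _

lemma sum_jointM {m : ℕ} (y : Fin m → 𝕐) : ∑ v, S.jointM v y = S.outM y := by
  have h := Finset.prod_univ_sum (fun _ : Fin m => (Finset.univ : Finset (Fin 2)))
    (fun i v => S.joint v (y i))
  rw [Fintype.piFinset_univ] at h
  exact h.symm

lemma sum_ofReal_jointM {m : ℕ} (y : Fin m → 𝕐) :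
    ∑ v, ENNReal.ofReal (S.jointM v y) = ENNReal.ofReal (S.outM y) := by
  rw [← sum_jointM, ENNReal.ofReal_sum_of_nonneg fun v _ => S.jointM_nonneg v y]

lemma jointLaw_eq_withDensity (m : ℕ) : S.jointLaw m =
    (Measure.count.prod (Measure.pi fun _ => S.ref)).withDensity fun x =>
      ENNReal.ofReal (S.jointM x.1 x.2) := by
  simp only [jointLaw, jointM, joint, Finset.prod_mul_distrib]

lemma measurable_jointM_uncurry (m : ℕ) :
    Measurable fun x : (Fin m → Fin 2) × (Fin m → 𝕐) => S.jointM x.1 x.2 :=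
  measurable_from_prod_countable_right fun v => S.measurable_jointM v

lemma lintegral_jointLaw {m : ℕ} {F : (Fin m → Fin 2) × (Fin m → 𝕐) → ENNReal}
    (hF : Measurable F) : ∫⁻ x, F x ∂S.jointLaw m =
      ∫⁻ y, ∑ v, ENNReal.ofReal (S.jointM v y) * F (v, y) ∂Measure.pi fun _ => S.ref := by
  have hm := (S.measurable_jointM_uncurry m).ennreal_ofReal
  rw [jointLaw_eq_withDensity, lintegral_withDensity_eq_lintegral_mul _ hm hF,
    lintegral_count_prod _ (hm.mul hF), lintegral_finsetSum]
  · rfl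
  · exact fun v _ => (hm.mul hF).comp measurable_prodMk_left

/-- The `m` snapshots are independent and identically distributed. -/
lemma measurePreserving_jointLaw (m : ℕ) : MeasurePreserving
    (MeasurableEquiv.arrowProdEquivProdArrow (Fin 2) 𝕐 (Fin m))
    (Measure.pi fun _ => S.snapshotLaw) (S.jointLaw m) := by
  have hint : Integrable (fun x : Fin 2 × 𝕐 => S.joint x.1 x.2) (Measure.count.prod S.ref) := by
    refine (lintegral_ofReal_ne_top_iff_integrable
      S.measurable_joint_uncurry.aestronglyMeasurable
      (ae_of_all _ fun x => S.joint_nonneg x.1 x.2)).1 ?_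
    have h : S.snapshotLaw Set.univ = 1 := measure_univ
    rw [snapshotLaw, withDensity_apply _ MeasurableSet.univ, Measure.restrict_univ] at h
    rw [h]
    exact ENNReal.one_ne_top
  have hcount : (Measure.pi fun _ : Fin m => (Measure.count : Measure (Fin 2))) =
      Measure.count := by
    refine Measure.ext_of_singleton fun v => ?_
    rw [Measure.pi_singleton]
    simp
  have hmp := measurePreserving_arrowProdEquivProdArrow (Fin 2) 𝕐 (Fin m)
    (fun _ => Measure.count) fun _ => S.ref
  rw [hcount] at hmp
  refine ⟨MeasurableEquiv.measurable _, ?_⟩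
  simp only [snapshotLaw]
  rw [pi_withDensity_ofReal _ hint fun x => S.joint_nonneg x.1 x.2, jointLaw_eq_withDensity]
  refine Measure.ext_of_lintegral _ fun F hF => ?_
  have hM := (S.measurable_jointM_uncurry m).ennreal_ofReal
  have hP : Measurable fun z : Fin m → Fin 2 × 𝕐 =>
      ENNReal.ofReal (∏ i, S.joint (z i).1 (z i).2) :=
    (Finset.measurable_prod _ fun i _ =>
      S.measurable_joint_uncurry.comp (measurable_pi_apply i)).ennreal_ofReal
  rw [lintegral_map hF (MeasurableEquiv.measurable _),
    lintegral_withDensity_eq_lintegral_mul _ hM hF, ← hmp.map_eq,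
    lintegral_map (hM.mul hF) (MeasurableEquiv.measurable _),
    lintegral_withDensity_eq_lintegral_mul _ hP
      (g := fun z => F (MeasurableEquiv.arrowProdEquivProdArrow (Fin 2) 𝕐 (Fin m) z))
      (hF.comp (MeasurableEquiv.measurable _))]
  rfl

instance (m : ℕ) : IsProbabilityMeasure (S.jointLaw m) :=
  (S.measurePreserving_jointLaw m).map_eq ▸
    Measure.isProbabilityMeasure_map (MeasurableEquiv.measurable _).aemeasurable

/-! ### Entropies of one snapshot -/

lemma abs_mul_logb_le {x : ℝ} (h0 : 0 ≤ x) (h1 : x ≤ 1) :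
    |x * Real.logb 2 x| ≤ 1 / Real.log 2 := by
  have hl : 0 < Real.log 2 := Real.log_pos one_lt_two
  rcases h0.eq_or_lt with rfl | h0
  · simpa using hl.le
  · have h := (Real.abs_log_mul_self_lt x h0 h1).le
    rw [Real.logb, mul_div_assoc', abs_div, abs_of_pos hl, mul_comm x]
    exact div_le_div_of_nonneg_right h hl.le

/-- The entropy, in bits, of the a posteriori distribution `P(· | y)`. -/
def posteriorEntropy (y : 𝕐) : ℝ := ∑ v, -(S.posterior v y * Real.logb 2 (S.posterior v y))

/-- The conditional entropy `H(V | Y)` of a single snapshot, in bits. -/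
def entropyVgivenY : ℝ := ∫ y, S.out y * S.posteriorEntropy y ∂S.ref

lemma measurable_posterior_mul_logb (v : Fin 2) :
    Measurable fun y => S.posterior v y * Real.logb 2 (S.posterior v y) :=
  (S.posterior_measurable v).mul ((Real.measurable_log.comp (S.posterior_measurable v)).div_const _)

lemma measurable_posteriorEntropy : Measurable S.posteriorEntropy :=
  Finset.measurable_sum _ fun v _ => (S.measurable_posterior_mul_logb v).neg

lemma norm_posteriorEntropy_le (y : 𝕐) :
    ‖S.posteriorEntropy y‖ ≤ ∑ _v : Fin 2, 1 / Real.log 2 :=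
  (norm_sum_le _ _).trans (Finset.sum_le_sum fun v _ => by
    rw [norm_neg]
    exact abs_mul_logb_le (S.posterior_nonneg v y) (S.posterior_le_one v y))

lemma integrable_out_mul_posterior (v : Fin 2) :
    Integrable (fun y => S.out y * (S.posterior v y * Real.logb 2 (S.posterior v y))) S.ref :=
  S.integrable_out.mul_bdd (S.measurable_posterior_mul_logb v).aestronglyMeasurable
    (ae_of_all _ fun y => abs_mul_logb_le (S.posterior_nonneg v y) (S.posterior_le_one v y))

/-- `I(V; Y) = H(V) - H(V | Y)`. -/
lemma detectionInformation_eq : S.detectionInformation = S.entropyV - S.entropyVgivenY := by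
  have hpt : ∀ v y, S.joint v y * Real.logb 2 (S.chan v y / S.out y) =
      -(S.joint v y * Real.logb 2 (S.prior v)) +
        S.out y * (S.posterior v y * Real.logb 2 (S.posterior v y)) := by
    intro v y
    rw [← mul_assoc, mul_comm (S.out y), posterior_mul_out]
    by_cases hj : S.joint v y = 0
    · simp [hj]
    have hp : S.prior v ≠ 0 := fun h => hj (by rw [joint, h, zero_mul])
    have hc : S.chan v y ≠ 0 := fun h => hj (by rw [joint, h, mul_zero])
    have ho : S.out y ≠ 0 := fun h => hj (by rw [← posterior_mul_out, h, mul_zero])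
    have hpost : S.posterior v y = S.prior v * (S.chan v y / S.out y) := by
      rw [posterior, if_neg ho, joint, mul_div_assoc]
    rw [hpost, Real.logb_mul hp (div_ne_zero hc ho)]
    ring
  have hi : ∀ v, Integrable (fun y => S.joint v y * Real.logb 2 (S.prior v)) S.ref := fun v =>
    (S.integrable_joint v).mul_const _
  have h2 : S.entropyVgivenY =
      -∑ v, ∫ y, S.out y * (S.posterior v y * Real.logb 2 (S.posterior v y)) ∂S.ref := by
    rw [← integral_finsetSum _ fun v _ => S.integrable_out_mul_posterior v, ← integral_neg]
    refine integral_congr_ae (ae_of_all _ fun y => ?_)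
    simp only [posteriorEntropy, Finset.sum_neg_distrib, Finset.mul_sum, mul_neg]
  rw [h2, entropyV, detectionInformation]
  have hv : ∀ v, ∫ y, S.joint v y * Real.logb 2 (S.chan v y / S.out y) ∂S.ref =
      -(S.prior v * Real.logb 2 (S.prior v)) +
        ∫ y, S.out y * (S.posterior v y * Real.logb 2 (S.posterior v y)) ∂S.ref := by
    intro v
    simp only [hpt v]
    rw [integral_add (hi v).fun_neg (S.integrable_out_mul_posterior v), integral_neg,
      integral_mul_const, integral_joint]
  simp only [hv, Finset.sum_add_distrib, Finset.sum_neg_distrib]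
  ring

lemma integrable_joint_mul_logb_out (hS : S.HasFiniteEntropy) (v : Fin 2) :
    Integrable (fun y => S.joint v y * Real.logb 2 (S.out y)) S.ref := by
  refine hS.mono ((S.joint_measurable v).mul
    ((Real.measurable_log.comp S.out_measurable).div_const _)).aestronglyMeasurable
    (ae_of_all _ fun y => ?_)
  rw [norm_mul, norm_mul, Real.norm_of_nonneg (S.joint_nonneg v y),
    Real.norm_of_nonneg (S.out_nonneg y)]
  exact mul_le_mul_of_nonneg_right
    (Finset.single_le_sum (fun v _ => S.joint_nonneg v y) (Finset.mem_univ v)) (norm_nonneg _)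

/-- Since `log p(v, y) = log p(y) + log P(v | y)` and `P log P` is bounded, finiteness of `h(Y)`
gives finiteness of `h(V, Y)`. -/
lemma integrable_joint_mul_logb_joint (hS : S.HasFiniteEntropy) (v : Fin 2) :
    Integrable (fun y => S.joint v y * Real.logb 2 (S.joint v y)) S.ref := by
  refine ((S.integrable_joint_mul_logb_out hS v).add (S.integrable_out_mul_posterior v)).congr
    (ae_of_all _ fun y => ?_)
  simp only [Pi.add_apply]
  rw [← mul_assoc (S.out y), mul_comm (S.out y), posterior_mul_out]
  by_cases hj : S.joint v y = 0
  · simp [hj]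
  have ho : S.out y ≠ 0 := fun h => hj (by rw [← posterior_mul_out, h, mul_zero])
  have hp : S.posterior v y ≠ 0 := fun h => hj (by rw [← posterior_mul_out, h, zero_mul])
  rw [← mul_add, ← Real.logb_mul ho hp, mul_comm (S.out y), posterior_mul_out]

lemma integral_snapshotLaw_neg_logb_prior :
    Integrable (fun x : Fin 2 × 𝕐 => -Real.logb 2 (S.prior x.1)) S.snapshotLaw ∧
      ∫ x, -Real.logb 2 (S.prior x.1) ∂S.snapshotLaw = S.entropyV := by
  have hf : Measurable fun x : Fin 2 × 𝕐 => -Real.logb 2 (S.prior x.1) :=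
    (measurable_of_countable fun v => -Real.logb 2 (S.prior v)).comp measurable_fst
  have hi : ∀ v, Integrable (fun y => S.joint v y * -Real.logb 2 (S.prior v)) S.ref := fun v =>
    (S.integrable_joint v).mul_const _
  refine ⟨S.integrable_snapshotLaw hf hi, ?_⟩
  rw [S.integral_snapshotLaw hf hi]
  simp only [integral_mul_const, integral_joint]
  simp only [entropyV, mul_neg, Finset.sum_neg_distrib]

lemma integral_snapshotLaw_neg_logb_out (hS : S.HasFiniteEntropy) :
    Integrable (fun x : Fin 2 × 𝕐 => -Real.logb 2 (S.out x.2)) S.snapshotLaw ∧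
      ∫ x, -Real.logb 2 (S.out x.2) ∂S.snapshotLaw = S.entropyY := by
  have hf : Measurable fun x : Fin 2 × 𝕐 => -Real.logb 2 (S.out x.2) :=
    ((Real.measurable_log.comp (S.out_measurable.comp measurable_snd)).div_const _).neg
  have hi : ∀ v, Integrable (fun y => S.joint v y * -Real.logb 2 (S.out y)) S.ref := fun v => by
    simpa only [mul_neg] using (S.integrable_joint_mul_logb_out hS v).fun_neg
  refine ⟨S.integrable_snapshotLaw hf hi, ?_⟩
  rw [S.integral_snapshotLaw hf hi, ← integral_finsetSum _ fun v _ => hi v, entropyY,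
    ← integral_neg]
  refine integral_congr_ae (ae_of_all _ fun y => ?_)
  simp only [← Finset.sum_mul]
  exact mul_neg _ _

lemma integral_snapshotLaw_neg_logb_joint (hS : S.HasFiniteEntropy) :
    Integrable (fun x : Fin 2 × 𝕐 => -Real.logb 2 (S.joint x.1 x.2)) S.snapshotLaw ∧
      ∫ x, -Real.logb 2 (S.joint x.1 x.2) ∂S.snapshotLaw = S.entropyVY := by
  have hf : Measurable fun x : Fin 2 × 𝕐 => -Real.logb 2 (S.joint x.1 x.2) :=
    ((Real.measurable_log.comp S.measurable_joint_uncurry).div_const _).neg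
  have hi : ∀ v, Integrable (fun y => S.joint v y * -Real.logb 2 (S.joint v y)) S.ref :=
    fun v => by simpa only [mul_neg] using (S.integrable_joint_mul_logb_joint hS v).fun_neg
  refine ⟨S.integrable_snapshotLaw hf hi, ?_⟩
  rw [S.integral_snapshotLaw hf hi, entropyVY]
  simp only [mul_neg, integral_neg, Finset.sum_neg_distrib]

lemma integral_snapshotLaw_posteriorEntropy :
    Integrable (fun x : Fin 2 × 𝕐 => S.posteriorEntropy x.2) S.snapshotLaw ∧
      ∫ x, S.posteriorEntropy x.2 ∂S.snapshotLaw = S.entropyVgivenY := by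
  have hf : Measurable fun x : Fin 2 × 𝕐 => S.posteriorEntropy x.2 :=
    S.measurable_posteriorEntropy.comp measurable_snd
  have hi : ∀ v, Integrable (fun y => S.joint v y * S.posteriorEntropy y) S.ref := fun v =>
    (S.integrable_joint v).mul_bdd S.measurable_posteriorEntropy.aestronglyMeasurable
      (ae_of_all _ S.norm_posteriorEntropy_le)
  refine ⟨S.integrable_snapshotLaw hf hi, ?_⟩
  rw [S.integral_snapshotLaw hf hi, ← integral_finsetSum _ fun v _ => hi v, entropyVgivenY]
  refine integral_congr_ae (ae_of_all _ fun y => ?_)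
  simp only [← Finset.sum_mul, out]

/-! ### Joint typicality -/

lemma measurableSet_jointlyTypical (ε : ℝ) (m : ℕ) : MeasurableSet (S.jointlyTypical ε m) := by
  have h1 : ∀ i : Fin m, Measurable fun x : (Fin m → Fin 2) × (Fin m → 𝕐) =>
      (x.1 i, x.2 i) := fun i => by fun_prop
  have hp : ∀ i : Fin m, Measurable fun x : (Fin m → Fin 2) × (Fin m → 𝕐) =>
      Real.logb 2 (S.prior (x.1 i)) := fun i =>
    ((measurable_of_countable fun v => Real.logb 2 (S.prior v)).comp measurable_fst).comp (h1 i)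
  have ho : ∀ i : Fin m, Measurable fun x : (Fin m → Fin 2) × (Fin m → 𝕐) =>
      Real.logb 2 (S.out (x.2 i)) := fun i =>
    (Real.measurable_log.comp ((S.out_measurable.comp measurable_snd).comp (h1 i))).div_const _
  have hj : ∀ i : Fin m, Measurable fun x : (Fin m → Fin 2) × (Fin m → 𝕐) =>
      S.joint (x.1 i) (x.2 i) := fun i => S.measurable_joint_uncurry.comp (h1 i)
  have hlj : ∀ i : Fin m, Measurable fun x : (Fin m → Fin 2) × (Fin m → 𝕐) =>
      Real.logb 2 (S.joint (x.1 i) (x.2 i)) := fun i =>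
    (Real.measurable_log.comp (hj i)).div_const _
  simp only [jointlyTypical, Set.ofPred_and]
  refine .inter ?_
    (.inter (measurableSet_lt ?_ measurable_const) (.inter (measurableSet_lt ?_ measurable_const)
      (measurableSet_lt ?_ measurable_const)))
  · rw [Set.ofPred_forall]
    exact MeasurableSet.iInter fun i => measurableSet_lt measurable_const (hj i)
  all_goals
    exact (((Finset.measurable_sum _ fun i _ => by first | exact hp i | exact ho i | exact hlj i
      ).const_mul _).sub_const _).abs

/-- The asymptotic equipartition property: independent snapshots are jointly typical with
probability tending to one. -/
lemma tendsto_jointLaw_compl_jointlyTypical (hS : S.HasFiniteEntropy) {ε : ℝ} (hε : 0 < ε) :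
    Tendsto (fun m : ℕ => S.jointLaw m (S.jointlyTypical ε m)ᶜ) atTop (𝓝 0) := by
  obtain ⟨hi1, he1⟩ := S.integral_snapshotLaw_neg_logb_prior
  obtain ⟨hi2, he2⟩ := S.integral_snapshotLaw_neg_logb_out hS
  obtain ⟨hi3, he3⟩ := S.integral_snapshotLaw_neg_logb_joint hS
  have t1 := tendsto_measure_sampleMean_ge S.snapshotLaw
    (f := fun x => -Real.logb 2 (S.prior x.1))
    (((measurable_of_countable fun v => Real.logb 2 (S.prior v)).comp measurable_fst).neg) hi1 hε
  have t2 := tendsto_measure_sampleMean_ge S.snapshotLaw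
    (f := fun x => -Real.logb 2 (S.out x.2))
    (((Real.measurable_log.comp (S.out_measurable.comp measurable_snd)).div_const _).neg) hi2 hε
  have t3 := tendsto_measure_sampleMean_ge S.snapshotLaw
    (f := fun x => -Real.logb 2 (S.joint x.1 x.2))
    (((Real.measurable_log.comp S.measurable_joint_uncurry).div_const _).neg) hi3 hε
  have t := (t1.add t2).add t3
  simp only [add_zero] at t
  rw [he1, he2, he3] at t
  refine tendsto_of_tendsto_of_tendsto_of_le_of_le tendsto_const_nhds t (fun _ => zero_le)
    fun m => ?_
  -- The positivity clause of joint typicality holds almost surely.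
  have hpos : ∀ᵐ x ∂S.jointLaw m, ∀ i, 0 < S.joint (x.1 i) (x.2 i) := by
    rw [jointLaw_eq_withDensity,
      ae_withDensity_iff (S.measurable_jointM_uncurry m).ennreal_ofReal]
    refine ae_of_all _ fun x hx i => (S.joint_nonneg _ _).lt_of_ne' fun h => hx ?_
    rw [jointM, Finset.prod_eq_zero (Finset.mem_univ i) h, ENNReal.ofReal_zero]
  have hmp := S.measurePreserving_jointLaw m
  have hpos' := hmp.quasiMeasurePreserving.ae hpos
  rw [← hmp.measure_preimage (S.measurableSet_jointlyTypical ε m).compl.nullMeasurableSet]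
  refine le_trans (measure_mono_ae ?_)
    ((measure_union_le _ _).trans (add_le_add_left (measure_union_le _ _) _))
  filter_upwards [hpos'] with z hz hmem
  change z ∈ (_ ∪ _ ∪ _ : Set (Fin m → Fin 2 × 𝕐))
  by_contra hcon
  refine hmem ⟨hz, ?_⟩
  simp only [Set.mem_union, not_or, Set.mem_ofPred_eq, not_le, Finset.sum_neg_distrib, mul_neg,
    ← neg_mul] at hcon
  obtain ⟨⟨h1, h2⟩, h3⟩ := hcon
  exact ⟨h1, h2, h3⟩

/-! ### The a posteriori law given a successful decision -/

section Success

variable {m : ℕ} (D : Kernel (Fin m → 𝕐) (Fin m → Fin 2)) [IsMarkovKernel D] (ε : ℝ)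

instance : IsProbabilityMeasure (S.law D) := by
  unfold law
  infer_instance

/-- The probability that the decision is successful, given the received sequence `y^m`. It does
not depend on the target states: this is the Markov property of `V^m → Y^m → V̂^m`. -/
def successProb (y : Fin m → 𝕐) : ENNReal := D y (S.condTypical ε m y)

lemma measurableSet_typicalPair : MeasurableSet
    {p : (Fin m → 𝕐) × (Fin m → Fin 2) | p.2 ∈ S.condTypical ε m p.1} :=
  measurable_swap (S.measurableSet_jointlyTypical ε m)

lemma measurableSet_successful : MeasurableSet (S.successful ε m) := by
  have h : Measurable fun ω : ((Fin m → Fin 2) × (Fin m → 𝕐)) × (Fin m → Fin 2) =>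
      (ω.1.2, ω.2) := by fun_prop
  exact h (S.measurableSet_typicalPair ε)

lemma measurable_successProb : Measurable (S.successProb D ε) :=
  Kernel.measurable_kernel_prodMk_left (S.measurableSet_typicalPair ε)

lemma lintegral_law_restrict_successful {F : (Fin m → Fin 2) × (Fin m → 𝕐) → ENNReal}
    (hF : Measurable F) : ∫⁻ ω in S.successful ε m, F ω.1 ∂S.law D =
      ∫⁻ y, ∑ v, ENNReal.ofReal (S.jointM v y) * (F (v, y) * S.successProb D ε y)
        ∂Measure.pi fun _ => S.ref := by
  have hE := S.measurableSet_successful (m := m) ε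
  have hG : Measurable fun x : (Fin m → Fin 2) × (Fin m → 𝕐) => F x * S.successProb D ε x.2 :=
    hF.mul ((S.measurable_successProb D ε).comp measurable_snd)
  have hF1 : Measurable fun ω : ((Fin m → Fin 2) × (Fin m → 𝕐)) × (Fin m → Fin 2) => F ω.1 :=
    hF.comp measurable_fst
  rw [← lintegral_indicator hE, law, Measure.lintegral_compProd (hF1.indicator hE),
    ← S.lintegral_jointLaw hG]
  refine lintegral_congr fun x => ?_
  have hset : MeasurableSet (S.condTypical ε m x.2) := Set.toFinite _ |>.measurableSet
  have h : ∀ b, (S.successful ε m).indicator (fun ω => F ω.1) (x, b) =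
      (S.condTypical ε m x.2).indicator (fun _ => F x) b := fun b => by
    by_cases hb : b ∈ S.condTypical ε m x.2
    · rw [Set.indicator_of_mem hb, Set.indicator_of_mem (show (x, b) ∈ S.successful ε m from hb)]
    · rw [Set.indicator_of_notMem hb,
        Set.indicator_of_notMem (show (x, b) ∉ S.successful ε m from hb)]
  simp only [h]
  rw [lintegral_indicator_const hset]
  rfl

/-- The law of `((V^m, Y^m), V̂^m)` given a successful decision. -/
def successLaw : Measure (((Fin m → Fin 2) × (Fin m → 𝕐)) × (Fin m → Fin 2)) :=
  cond (S.law D) (S.successful ε m)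

lemma lintegral_successLaw {F : (Fin m → Fin 2) × (Fin m → 𝕐) → ENNReal}
    (hF : Measurable F) : ∫⁻ ω, F ω.1 ∂S.successLaw D ε =
      (S.law D (S.successful ε m))⁻¹ *
        ∫⁻ y, ∑ v, ENNReal.ofReal (S.jointM v y) * (F (v, y) * S.successProb D ε y)
          ∂Measure.pi fun _ => S.ref := by
  rw [successLaw, ProbabilityTheory.cond, lintegral_smul_measure,
    S.lintegral_law_restrict_successful D ε hF, smul_eq_mul]

/-- Conditioning on success does not change the a posteriori law of the target states, because
success depends on `(Y^m, V̂^m)` only. -/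
lemma condProb_successLaw [IsProbabilityMeasure (S.successLaw D ε)] (a : Fin m → Fin 2) :
    (fun ω => S.posteriorM a ω.1.2) =ᵐ[S.successLaw D ε]
      (S.successLaw D ε)⟦(fun ω => ω.1.1) ⁻¹' {a} |
        MeasurableSpace.comap (fun ω => ω.1.2) inferInstance⟧ := by
  have hY : Measurable fun ω : ((Fin m → Fin 2) × (Fin m → 𝕐)) × (Fin m → Fin 2) => ω.1.2 := by
    fun_prop
  have hV : Measurable fun ω : ((Fin m → Fin 2) × (Fin m → 𝕐)) × (Fin m → Fin 2) => ω.1.1 := by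
    fun_prop
  have ha : MeasurableSet ((fun ω : ((Fin m → Fin 2) × (Fin m → 𝕐)) × (Fin m → Fin 2) =>
      ω.1.1) ⁻¹' {a}) := hV (measurableSet_singleton a)
  have hpost := (S.measurable_posteriorM a).comp hY
  have hint : Integrable (fun ω : ((Fin m → Fin 2) × (Fin m → 𝕐)) × (Fin m → Fin 2) =>
      S.posteriorM a ω.1.2) (S.successLaw D ε) :=
    Integrable.of_bound hpost.aestronglyMeasurable 1 (ae_of_all _ fun ω => by
      rw [Real.norm_of_nonneg (S.posteriorM_nonneg _ _)]
      exact S.posteriorM_le_one _ _)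
  refine ae_eq_condExp_of_forall_setIntegral_eq hY.comap_le
    ((integrable_const (1 : ℝ)).indicator ha) (fun s _ _ => hint.integrableOn) ?_
    (Measurable.aestronglyMeasurable
      ((S.measurable_posteriorM a).comp (comap_measurable _)))
  rintro s ⟨t, ht, rfl⟩ -
  have hs := hY ht
  rw [integral_eq_lintegral_of_nonneg_ae (ae_of_all _ fun ω => S.posteriorM_nonneg _ _)
      hpost.aestronglyMeasurable,
    integral_eq_lintegral_of_nonneg_ae
      (ae_of_all _ fun ω => Set.indicator_nonneg (fun _ _ => zero_le_one) _)
      (measurable_const.indicator ha).aestronglyMeasurable]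
  congr 1
  rw [← lintegral_indicator hs, ← lintegral_indicator hs]
  let F : (Fin m → Fin 2) × (Fin m → 𝕐) → ENNReal := fun x =>
    t.indicator (fun y => ENNReal.ofReal (S.posteriorM a y)) x.2
  let G : (Fin m → Fin 2) × (Fin m → 𝕐) → ENNReal := fun x =>
    t.indicator (fun _ => if x.1 = a then 1 else 0) x.2
  have hF : Measurable F :=
    ((S.measurable_posteriorM a).ennreal_ofReal.indicator ht).comp measurable_snd
  have hG : Measurable G := measurable_from_prod_countable_right fun v =>
    (measurable_const (a := if v = a then (1 : ENNReal) else 0)).indicator ht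
  have e1 : ∫⁻ ω, ((fun ω : ((Fin m → Fin 2) × (Fin m → 𝕐)) × (Fin m → Fin 2) => ω.1.2) ⁻¹'
      t).indicator (fun ω => ENNReal.ofReal (S.posteriorM a ω.1.2)) ω ∂S.successLaw D ε =
      ∫⁻ ω, F ω.1 ∂S.successLaw D ε := lintegral_congr fun ω => rfl
  have e2 : ∫⁻ ω, ((fun ω : ((Fin m → Fin 2) × (Fin m → 𝕐)) × (Fin m → Fin 2) => ω.1.2) ⁻¹'
      t).indicator (fun ω => ENNReal.ofReal (((fun ω : ((Fin m → Fin 2) × (Fin m → 𝕐)) ×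
        (Fin m → Fin 2) => ω.1.1) ⁻¹' {a}).indicator (fun _ => (1 : ℝ)) ω)) ω
        ∂S.successLaw D ε = ∫⁻ ω, G ω.1 ∂S.successLaw D ε := lintegral_congr fun ω => by
    by_cases h1 : ω.1.2 ∈ t <;> by_cases h2 : ω.1.1 = a <;> simp [G, Set.indicator, h1, h2]
  refine e1.trans (Eq.trans ?_ e2.symm)
  rw [S.lintegral_successLaw D ε hF, S.lintegral_successLaw D ε hG]
  congr 1
  -- Both integrands are `p(a, y)` times the success probability on `t`, and vanish off `t`.
  refine lintegral_congr fun y => ?_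
  by_cases hy : y ∈ t
  · simp only [F, G, Set.indicator_of_mem hy, ite_mul, one_mul, zero_mul, mul_ite, mul_zero,
      Finset.sum_ite_eq', Finset.mem_univ, if_true]
    rw [← Finset.sum_mul, sum_ofReal_jointM, ← mul_assoc,
      ← ENNReal.ofReal_mul (S.outM_nonneg y), mul_comm (S.outM y), posteriorM_mul_outM]
  · simp [F, G, hy]

end Success

/-- The entropy of a product distribution is the sum of the entropies. -/
lemma sum_posteriorM_mul_logb {m : ℕ} (y : Fin m → 𝕐) :
    ∑ a, -(S.posteriorM a y * Real.logb 2 (S.posteriorM a y)) =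
      ∑ i, S.posteriorEntropy (y i) := by
  -- A vanishing product contributes zero to both sides, whatever `logb 2 0` is.
  have hlog : ∀ a : Fin m → Fin 2, S.posteriorM a y * Real.logb 2 (S.posteriorM a y) =
      ∑ i, S.posteriorM a y * Real.logb 2 (S.posterior (a i) (y i)) := by
    intro a
    by_cases h : S.posteriorM a y = 0
    · simp [h]
    · rw [← Finset.mul_sum, ← Real.logb_prod _ _ (Finset.prod_ne_zero_iff.1 h)]
      rfl
  -- The `i`-th marginal of the product distribution is its `i`-th factor.
  have hmarg : ∀ i : Fin m, ∑ a, S.posteriorM a y * Real.logb 2 (S.posterior (a i) (y i)) =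
      ∑ v, S.posterior v (y i) * Real.logb 2 (S.posterior v (y i)) := by
    intro i
    have h := Finset.prod_univ_sum (fun _ : Fin m => (Finset.univ : Finset (Fin 2)))
      (fun j v => S.posterior v (y j) *
        if j = i then Real.logb 2 (S.posterior v (y j)) else 1)
    rw [Fintype.piFinset_univ] at h
    simp only [Finset.prod_mul_distrib, Finset.prod_ite_eq', Finset.mem_univ, if_true] at h
    refine Eq.trans h.symm ?_
    rw [Finset.prod_eq_single i]
    · simp
    · intro j _ hj
      simp [hj, S.posterior_sum]
    · simp
  simp only [hlog, Finset.sum_neg_distrib, posteriorEntropy]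
  rw [Finset.sum_comm, Finset.sum_congr rfl fun i _ => hmarg i]

/-! ### Convergence of the empirical detection information -/

section Success

variable {m : ℕ} (D : Kernel (Fin m → 𝕐) (Fin m → Fin 2)) [IsMarkovKernel D] (ε : ℝ)

/-- The empirical entropy is the mean of the empirical a posteriori entropy of `Y^m`, given
success. -/
lemma empiricalEntropy_eq [IsProbabilityMeasure (S.successLaw D ε)] : S.empiricalEntropy ε D =
    ∫ ω, 1 / (m : ℝ) * ∑ i, S.posteriorEntropy (ω.1.2 i) ∂S.successLaw D ε := by
  rw [integral_const_mul, empiricalEntropy, condEntropy]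
  congr 1
  refine integral_congr_ae ?_
  filter_upwards [ae_all_iff.2 (S.condProb_successLaw D ε)] with ω hω
  rw [← sum_posteriorM_mul_logb]
  refine Finset.sum_congr rfl fun a _ => ?_
  rw [hω a]
  rfl

lemma measurable_mean_posteriorEntropy : Measurable
    fun x : (Fin m → Fin 2) × (Fin m → 𝕐) => 1 / (m : ℝ) * ∑ i, S.posteriorEntropy (x.2 i) := by
  have := S.measurable_posteriorEntropy
  fun_prop

/-- Up to the factor `1 / P(E = 0)`, conditioning on success does not increase the mean deviation
of the empirical a posteriori entropy. -/
lemma enorm_empiricalEntropy_sub_le (hpos : S.law D (S.successful ε m) ≠ 0) :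
    ‖S.empiricalEntropy ε D - S.entropyVgivenY‖ₑ ≤ (S.law D (S.successful ε m))⁻¹ *
      ∫⁻ z : Fin m → Fin 2 × 𝕐, ‖1 / (m : ℝ) * ∑ i, S.posteriorEntropy (z i).2 -
        S.entropyVgivenY‖ₑ ∂Measure.pi fun _ => S.snapshotLaw := by
  have : IsProbabilityMeasure (S.successLaw D ε) := cond_isProbabilityMeasure hpos
  have hm := S.measurable_mean_posteriorEntropy (m := m)
  have hfm : Measurable fun x : (Fin m → Fin 2) × (Fin m → 𝕐) =>
      ‖1 / (m : ℝ) * ∑ i, S.posteriorEntropy (x.2 i) - S.entropyVgivenY‖ₑ :=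
    (hm.sub_const _).enorm
  have hi : Integrable (fun ω : ((Fin m → Fin 2) × (Fin m → 𝕐)) × (Fin m → Fin 2) =>
      1 / (m : ℝ) * ∑ i, S.posteriorEntropy (ω.1.2 i)) (S.successLaw D ε) := by
    refine Integrable.of_bound (hm.comp measurable_fst).aestronglyMeasurable
      (1 / (m : ℝ) * ∑ _i : Fin m, ∑ _v : Fin 2, 1 / Real.log 2) (ae_of_all _ fun ω => ?_)
    rw [norm_mul, Real.norm_of_nonneg (by positivity)]
    refine mul_le_mul_of_nonneg_left ((norm_sum_le _ _).trans
      (Finset.sum_le_sum fun i _ => S.norm_posteriorEntropy_le _)) (by positivity)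
  calc ‖S.empiricalEntropy ε D - S.entropyVgivenY‖ₑ
      = ‖∫ ω, (1 / (m : ℝ) * ∑ i, S.posteriorEntropy (ω.1.2 i) - S.entropyVgivenY)
          ∂S.successLaw D ε‖ₑ := by
        rw [integral_sub hi (integrable_const _), integral_const, probReal_univ, one_smul,
          S.empiricalEntropy_eq D ε]
    _ ≤ ∫⁻ ω, ‖1 / (m : ℝ) * ∑ i, S.posteriorEntropy (ω.1.2 i) - S.entropyVgivenY‖ₑ
          ∂S.successLaw D ε := enorm_integral_le_lintegral_enorm _
    _ = (S.law D (S.successful ε m))⁻¹ * ∫⁻ ω in S.successful ε m,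
          ‖1 / (m : ℝ) * ∑ i, S.posteriorEntropy (ω.1.2 i) - S.entropyVgivenY‖ₑ ∂S.law D := by
        rw [successLaw, ProbabilityTheory.cond, lintegral_smul_measure, smul_eq_mul]
    _ ≤ (S.law D (S.successful ε m))⁻¹ * ∫⁻ ω,
          ‖1 / (m : ℝ) * ∑ i, S.posteriorEntropy (ω.1.2 i) - S.entropyVgivenY‖ₑ ∂S.law D := by
        exact mul_le_mul_right (setLIntegral_le_lintegral _ _) _
    _ = _ := by
        congr 1
        have hfst : (S.law D).map Prod.fst = S.jointLaw m := Measure.fst_compProd _ _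
        rw [← lintegral_map hfm measurable_fst, hfst,
          ← (S.measurePreserving_jointLaw m).lintegral_comp hfm]
        rfl

end Success

/-- Whenever decisions succeed with probability tending to one, whatever the detectors are, the
empirical detection information converges to the detection information. -/
lemma tendsto_empiricalDI {ε : ℝ} (D : ∀ m : ℕ, Kernel (Fin m → 𝕐) (Fin m → Fin 2))
    [∀ m, IsMarkovKernel (D m)]
    (hD : Tendsto (fun m => S.failProb ε (D m)) atTop (𝓝 0)) :
    Tendsto (fun m => S.empiricalDI ε (D m)) atTop (𝓝 S.detectionInformation) := by
  obtain ⟨hi, he⟩ := S.integral_snapshotLaw_posteriorEntropy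
  have hL := tendsto_lintegral_sampleMean_sub S.snapshotLaw
    (f := fun x => S.posteriorEntropy x.2)
    (S.measurable_posteriorEntropy.comp measurable_snd) hi
  rw [he] at hL
  have hfail : Tendsto (fun m => S.law (D m) (S.successful ε m)ᶜ) atTop (𝓝 0) := by
    have h := ENNReal.tendsto_ofReal hD
    simpa [failProb, Measure.real, ENNReal.ofReal_toReal] using h
  have hsucc : Tendsto (fun m => S.law (D m) (S.successful ε m)) atTop (𝓝 1) := by
    have h := ENNReal.Tendsto.sub (tendsto_const_nhds (x := (1 : ENNReal))) hfail
      (Or.inl ENNReal.one_ne_top)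
    rw [tsub_zero] at h
    refine h.congr fun m => ?_
    rw [← prob_compl_eq_one_sub (S.measurableSet_successful ε).compl, compl_compl]
  have hbound := ENNReal.Tendsto.mul (tendsto_inv_iff.2 hsucc)
    (Or.inr ENNReal.zero_ne_top) hL (Or.inr (by simp))
  rw [mul_zero] at hbound
  have hent : Tendsto (fun m => S.empiricalEntropy ε (D m)) atTop (𝓝 S.entropyVgivenY) := by
    rw [tendsto_iff_edist_tendsto_0]
    refine tendsto_of_tendsto_of_tendsto_of_le_of_le' tendsto_const_nhds hbound
      (Eventually.of_forall fun _ => zero_le) ?_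
    filter_upwards [hsucc.eventually_ne one_ne_zero] with m hm
    rw [edist_eq_enorm_sub]
    exact S.enorm_empiricalEntropy_sub_le (D m) ε hm
  rw [detectionInformation_eq]
  exact tendsto_const_nhds.sub hent

/-! ### The sampling a posteriori detector -/

/-- With the sampling a posteriori detector `(V̂^m, Y^m)` has the law of `(V^m, Y^m)`. -/
lemma law_sapDetector_compl_successful (ε : ℝ) (m : ℕ) :
    S.law (S.sapDetector m) (S.successful ε m)ᶜ = S.jointLaw m (S.jointlyTypical ε m)ᶜ := by
  have hE := (S.measurableSet_successful (m := m) ε).compl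
  have hA := (S.measurableSet_jointlyTypical ε m).compl
  have hind : ∀ v : Fin m → Fin 2, Measurable fun y : Fin m → 𝕐 =>
      (S.jointlyTypical ε m)ᶜ.indicator (fun _ => (1 : ENNReal)) (v, y) := fun v =>
    (measurable_const.indicator hA).comp measurable_prodMk_left
  let G : (Fin m → 𝕐) → ENNReal := fun y => ∑ v, ENNReal.ofReal (S.posteriorM v y) *
    (S.jointlyTypical ε m)ᶜ.indicator (fun _ => (1 : ENNReal)) (v, y)
  have hG : Measurable G := Finset.measurable_sum _ fun v _ =>
    (S.measurable_posteriorM v).ennreal_ofReal.mul (hind v)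
  have hsap : ∀ x : (Fin m → Fin 2) × (Fin m → 𝕐),
      (S.sapDetector m).prodMkLeft (Fin m → Fin 2) x (Prod.mk x ⁻¹' (S.successful ε m)ᶜ) =
        G x.2 := by
    intro x
    change (∑ v : Fin m → Fin 2, ENNReal.ofReal (S.posteriorM v x.2) • Measure.dirac v)
      (Prod.mk x ⁻¹' (S.successful ε m)ᶜ) = G x.2
    simp only [Measure.coe_finsetSum, Finset.sum_apply, Measure.smul_apply, smul_eq_mul]
    refine Finset.sum_congr rfl fun v _ => ?_
    rw [Measure.dirac_apply]
    rfl
  rw [law, Measure.compProd_apply hE, lintegral_congr hsap,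
    S.lintegral_jointLaw (F := fun x => G x.2) (hG.comp measurable_snd),
    ← lintegral_indicator_one hA,
    S.lintegral_jointLaw (measurable_one.indicator hA)]
  refine lintegral_congr fun y => ?_
  change ∑ v, ENNReal.ofReal (S.jointM v y) * G y = _
  rw [← Finset.sum_mul, sum_ofReal_jointM, Finset.mul_sum]
  refine Finset.sum_congr rfl fun v _ => ?_
  rw [← mul_assoc, ← ENNReal.ofReal_mul (S.outM_nonneg y), mul_comm (S.outM y),
    posteriorM_mul_outM]
  rfl

lemma tendsto_failProb_sapDetector (hS : S.HasFiniteEntropy) {ε : ℝ} (hε : 0 < ε) :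
    Tendsto (fun m : ℕ => S.failProb ε (S.sapDetector m)) atTop (𝓝 0) := by
  have h := (ENNReal.tendsto_toReal ENNReal.zero_ne_top).comp
    (S.tendsto_jointLaw_compl_jointlyTypical hS hε)
  refine h.congr fun m => ?_
  rw [Function.comp_apply, ← law_sapDetector_compl_successful]
  rfl

end DetectionSystem

/-! ### Finite entropy of the radar channel -/

lemma mean_le_of_le {a b : ℝ} (hab : a < b) {f : ℝ → ℝ} (hf : Continuous f) {B : ℝ}
    (h : ∀ x ∈ Set.Icc a b, f x ≤ B) : 1 / (b - a) * ∫ x in a..b, f x ≤ B := by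
  have hba : 0 < b - a := sub_pos.2 hab
  have h1 : ∫ x in a..b, f x ≤ ∫ _ in a..b, B :=
    intervalIntegral.integral_mono_on hab.le (hf.intervalIntegrable a b)
    (continuous_const.intervalIntegrable a b) h
  rw [intervalIntegral.integral_const, smul_eq_mul] at h1
  calc 1 / (b - a) * ∫ x in a..b, f x ≤ 1 / (b - a) * ((b - a) * B) :=
        mul_le_mul_of_nonneg_left h1 (by positivity)
    _ = B := by field_simp

lemma exists_norm_radarEcho_le (N : ℕ) {ψ : ℝ → ℂ} (hψ : Continuous ψ) (α : ℝ) :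
    ∃ M, ∀ (v : Fin 2) (φ : ℝ) (n : Fin N), ∀ x ∈ Set.Icc (-(N : ℝ) / 2) ((N : ℝ) / 2),
      ‖radarEcho N ψ α v x φ n‖ ≤ M := by
  obtain ⟨C, hC⟩ := isCompact_Icc.exists_bound_of_continuousOn
    (s := Set.Icc (-(N : ℝ)) N) hψ.continuousOn
  refine ⟨1 * (|α| * 1) * C, fun v φ n x hx => ?_⟩
  have hn : ((n : ℕ) : ℝ) ≤ N := Nat.cast_le.2 n.2.le
  have hn0 : (0 : ℝ) ≤ (n : ℕ) := Nat.cast_nonneg _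
  have hv : ((v : ℕ) : ℝ) ≤ 1 := by exact_mod_cast Nat.lt_succ_iff.1 v.2
  have hψx := hC (-(N : ℝ) / 2 + (n : ℕ) - x) ⟨by linarith [hx.2], by linarith [hx.1]⟩
  rw [radarEcho, norm_mul, norm_mul, norm_mul, mul_comm Complex.I, Complex.norm_exp_ofReal_mul_I,
    Complex.norm_natCast, Complex.norm_real, Real.norm_eq_abs]
  gcongr

/-- A Gaussian density with a bounded centre is dominated by a centred Gaussian of twice the
variance. -/
lemma complexGaussianDensity_le (N : ℕ) {N₀ : ℝ} (h : 0 < N₀) {M : ℝ} {c : Fin N → ℂ}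
    (hc : ∀ n, ‖c n‖ ≤ M) (y : Fin N → ℂ) : complexGaussianDensity N N₀ c y ≤
      (1 / (Real.pi * N₀)) ^ N * Real.exp (1 / N₀ * (N * M ^ 2)) *
        Real.exp (-(1 / (4 * N₀)) * ∑ n, ‖y n‖ ^ 2) ^ 2 := by
  have hn : ∀ n, 1 / 2 * ‖y n‖ ^ 2 - M ^ 2 ≤ ‖y n - c n‖ ^ 2 := by
    intro n
    have h1 : ‖y n‖ ≤ ‖y n - c n‖ + ‖c n‖ := by simpa using norm_add_le (y n - c n) (c n)
    have h2 : ‖y n‖ ≤ ‖y n - c n‖ + M := h1.trans (add_le_add_right (hc n) _)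
    nlinarith [sq_nonneg (‖y n - c n‖ - M), norm_nonneg (y n)]
  have hs := Finset.sum_le_sum fun n (_ : n ∈ Finset.univ) => hn n
  rw [Finset.sum_sub_distrib, ← Finset.mul_sum, Finset.sum_const, Finset.card_univ,
    Fintype.card_fin, nsmul_eq_mul] at hs
  rw [complexGaussianDensity, mul_assoc, ← Real.exp_nat_mul, ← Real.exp_add]
  refine mul_le_mul_of_nonneg_left (Real.exp_le_exp.2 ?_) (by positivity)
  have h3 := mul_le_mul_of_nonneg_left hs (by positivity : (0 : ℝ) ≤ 1 / N₀)
  calc -(1 / N₀) * ∑ n, ‖y n - c n‖ ^ 2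
      ≤ -(1 / N₀ * (1 / 2 * ∑ n, ‖y n‖ ^ 2 - N * M ^ 2)) := by linarith
    _ = _ := by
      push_cast
      field_simp
      ring

lemma integrable_exp_neg_mul_sum_sq (N : ℕ) {N₀ : ℝ} (h : 0 < N₀) :
    Integrable fun y : Fin N → ℂ => Real.exp (-(1 / N₀) * ∑ n, ‖y n‖ ^ 2) := by
  have hc : Continuous (complexGaussianDensity N N₀ 0) := by
    unfold complexGaussianDensity
    fun_prop
  have hi : Integrable (complexGaussianDensity N N₀ 0) := by
    refine (lintegral_ofReal_ne_top_iff_integrable hc.aestronglyMeasurable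
      (ae_of_all _ (complexGaussianDensity_nonneg N h 0))).1 ?_
    rw [complexGaussianDensity_lintegral N h]
    exact ENNReal.one_ne_top
  have h0 : (1 / (Real.pi * N₀)) ^ N ≠ 0 := by positivity
  refine (hi.const_mul ((1 / (Real.pi * N₀)) ^ N)⁻¹).congr (ae_of_all _ fun y => ?_)
  simp only [complexGaussianDensity, Pi.zero_apply, sub_zero]
  rw [inv_mul_cancel_left₀ h0]

/-- The square root takes care of small values, the square of large ones. -/
lemma abs_mul_log_le {p : ℝ} (hp : 0 ≤ p) : |p * Real.log p| ≤ 2 * √p + p ^ 2 := by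
  rcases hp.eq_or_lt with rfl | hp
  · simp
  rcases le_total p 1 with h1 | h1
  · have h := (Real.abs_log_mul_self_rpow_lt p (1 / 2) hp h1 (by norm_num)).le
    rw [← Real.sqrt_eq_rpow] at h
    calc |p * Real.log p| = √p * |Real.log p * √p| := by
          rw [← abs_of_nonneg (Real.sqrt_nonneg p), ← abs_mul, abs_of_nonneg (Real.sqrt_nonneg p)]
          congr 1
          nth_rewrite 1 [← Real.mul_self_sqrt hp.le]
          ring
      _ ≤ √p * (1 / (1 / 2)) := mul_le_mul_of_nonneg_left h (Real.sqrt_nonneg p)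
      _ ≤ 2 * √p + p ^ 2 := by nlinarith [sq_nonneg p]
  · have hl := Real.log_nonneg h1
    rw [abs_of_nonneg (mul_nonneg hp.le hl)]
    nlinarith [Real.log_le_sub_one_of_pos hp, Real.sqrt_nonneg p]

/-- A density dominated by the square of a bounded integrable function has a finite entropy. -/
lemma integrable_mul_logb_of_le_sq {Y : Type*} [MeasurableSpace Y] {μ : Measure Y} {p g : Y → ℝ}
    {K : ℝ} (hpm : Measurable p) (hp : ∀ y, 0 ≤ p y) (hg : Integrable g μ) (hg0 : ∀ y, 0 ≤ g y)
    (hg1 : ∀ y, g y ≤ 1) (hK : 0 ≤ K) (h : ∀ y, p y ≤ K * g y ^ 2) :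
    Integrable (fun y => p y * Real.logb 2 (p y)) μ := by
  have hlog : Integrable (fun y => p y * Real.log (p y)) μ := by
    refine (hg.const_mul (2 * √K + K ^ 2)).mono'
      (hpm.mul (Real.measurable_log.comp hpm)).aestronglyMeasurable (ae_of_all _ fun y => ?_)
    have h1 : √(p y) ≤ √K * g y := by
      rw [← Real.sqrt_sq (hg0 y), ← Real.sqrt_mul hK]
      exact Real.sqrt_le_sqrt (h y)
    have h2 : p y ^ 2 ≤ K ^ 2 * g y :=
      calc p y ^ 2 ≤ (K * g y ^ 2) ^ 2 := pow_le_pow_left₀ (hp y) (h y) 2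
        _ = K ^ 2 * g y ^ 4 := by ring
        _ ≤ K ^ 2 * g y := mul_le_mul_of_nonneg_left
          (pow_le_of_le_one (hg0 y) (hg1 y) four_ne_zero) (sq_nonneg K)
    calc ‖p y * Real.log (p y)‖ ≤ 2 * √(p y) + p y ^ 2 := abs_mul_log_le (hp y)
      _ ≤ (2 * √K + K ^ 2) * g y := by linarith
  refine (hlog.div_const (Real.log 2)).congr (ae_of_all _ fun y => ?_)
  exact mul_div_assoc _ _ _

/-- The Gaussian bound survives the averages over phase and delay, and is written as a square
because the entropy integrand is controlled by the square root of the density. -/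
lemma exists_radarChannel_le {N : ℕ} (hN : 0 < N) {N₀ : ℝ} (h : 0 < N₀) {ψ : ℝ → ℂ}
    (hψ : Continuous ψ) (α : ℝ) : ∃ K, 0 ≤ K ∧ ∀ v y, radarChannel N N₀ ψ α v y ≤
      K * Real.exp (-(1 / (4 * N₀)) * ∑ n, ‖y n‖ ^ 2) ^ 2 := by
  obtain ⟨M, hM⟩ := exists_norm_radarEcho_le N hψ α
  refine ⟨(1 / (Real.pi * N₀)) ^ N * Real.exp (1 / N₀ * (N * M ^ 2)), by positivity,
    fun v y => ?_⟩
  have hN' : (0 : ℝ) < N := Nat.cast_pos.2 hN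
  have key := mean_le_of_le (show -(N : ℝ) / 2 < (N : ℝ) / 2 by linarith)
    ((radar_inner_continuous N N₀ hψ α v).comp (Continuous.prodMk_right y)) fun x hx => by
      have hφ := mean_le_of_le Real.two_pi_pos
        ((radar_continuous N N₀ hψ α v).comp (Continuous.prodMk_right (y, x))) fun φ _ =>
          complexGaussianDensity_le N h (fun n => hM v φ n x hx) y
      rw [sub_zero] at hφ
      exact hφ
  rw [show (N : ℝ) / 2 - -(N : ℝ) / 2 = N by ring] at key
  exact key

lemma radarSystem_hasFiniteEntropy (N : ℕ) (hN : 0 < N) (N₀ : ℝ) (hN₀ : 0 < N₀) (ψ : ℝ → ℂ)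
    (hψ : Continuous ψ) (α : ℝ) (prior : Fin 2 → ℝ) (hprior : ∀ v, 0 ≤ prior v)
    (hsum : ∑ v, prior v = 1) :
    (radarSystem N hN N₀ hN₀ ψ hψ α prior hprior hsum).HasFiniteEntropy := by
  obtain ⟨K, hK, hle⟩ := exists_radarChannel_le hN hN₀ hψ α
  let S := radarSystem N hN N₀ hN₀ ψ hψ α prior hprior hsum
  refine integrable_mul_logb_of_le_sq S.out_measurable S.out_nonneg
    (integrable_exp_neg_mul_sum_sq N (by positivity : 0 < 4 * N₀)) (fun y => (Real.exp_pos _).le)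
    (fun y => Real.exp_le_one_iff.2 ?_) hK fun y => ?_
  · rw [neg_mul]
    exact neg_nonpos.2 (by positivity)
  · calc S.out y ≤ ∑ v, prior v * (K * Real.exp (-(1 / (4 * N₀)) * ∑ n, ‖y n‖ ^ 2) ^ 2) :=
        Finset.sum_le_sum fun v _ => mul_le_mul_of_nonneg_left (hle v y) (hprior v)
      _ = _ := by rw [← Finset.sum_mul, hsum, one_mul]

end

theorem theorem2 :
    -- every detection system whose signal density has a finite entropy
    (∀ (𝕐 : Type*) [MeasurableSpace 𝕐] (S : DetectionSystem 𝕐), S.HasFiniteEntropy →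
      -- achievability by the sampling a posteriori detector
      (∀ ε : ℝ, 0 < ε →
        (∀ᶠ m : ℕ in atTop,
          S.detectionInformation - 2 * ε < S.empiricalDI ε (S.sapDetector m)) ∧
        Tendsto (fun m : ℕ => S.failProb ε (S.sapDetector m)) atTop (𝓝 0)) ∧
      -- every value below the detection information is achievable
      (∀ ε : ℝ, 0 < ε → ∀ R : ℝ, R < S.detectionInformation →
        ∃ D : ∀ m : ℕ, Kernel (Fin m → 𝕐) (Fin m → Fin 2), (∀ m, IsMarkovKernel (D m)) ∧
          (∀ᶠ m : ℕ in atTop, R < S.empiricalDI ε (D m)) ∧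
          Tendsto (fun m : ℕ => S.failProb ε (D m)) atTop (𝓝 0)) ∧
      -- converse: no value above the detection information is achievable
      (∀ ε : ℝ, 0 < ε →
        ∀ D : ∀ m : ℕ, Kernel (Fin m → 𝕐) (Fin m → Fin 2), (∀ m, IsMarkovKernel (D m)) →
          Tendsto (fun m : ℕ => S.failProb ε (D m)) atTop (𝓝 0) →
          ∀ R : ℝ, S.detectionInformation < R →
            ∀ᶠ m : ℕ in atTop, S.empiricalDI ε (D m) < R)) ∧
    -- the radar detection channel is such a system
    (∀ (N : ℕ) (hN : 0 < N) (N₀ : ℝ) (hN₀ : 0 < N₀) (ψ : ℝ → ℂ) (hψ : Continuous ψ) (α : ℝ)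
      (prior : Fin 2 → ℝ) (hprior : ∀ v, 0 ≤ prior v) (hsum : ∑ v, prior v = 1),
      (radarSystem N hN N₀ hN₀ ψ hψ α prior hprior hsum).HasFiniteEntropy) := by
  refine ⟨fun 𝕐 _ S hS => ⟨fun ε hε => ?_, fun ε hε R hR => ?_, fun ε _ D hM hD R hR => ?_⟩,
    radarSystem_hasFiniteEntropy⟩
  · have hfail := S.tendsto_failProb_sapDetector hS hε
    exact ⟨(S.tendsto_empiricalDI _ hfail).eventually_const_lt (by linarith), hfail⟩
  · have hfail := S.tendsto_failProb_sapDetector hS hε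
    exact ⟨S.sapDetector, fun m => inferInstance,
      (S.tendsto_empiricalDI _ hfail).eventually_const_lt hR, hfail⟩
  · exact (S.tendsto_empiricalDI D hD).eventually_lt_const hR
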